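/- Let $n\ge 1$, let $H$ be a real symmetric $n\times n$ matrix with eigenvalues $\alpha_1\le\alpha_2\le\dots\le\alpha_n$ (counted with multiplicity), let $c\in\mathbb{R}^n$, $\sigma>0$ and $p>2$, and let $$g(x)=\tfrac12 x^THx+c^Tx+\tfrac{\sigma}{p}\|x\|^p,\qquad x\in\mathbb{R}^n,$$ where $\|\cdot\|$ is the Euclidean norm. A point $x\in\mathbb{R}^n$ is a local minimizer of $g$ that is not a global minimizer of $g$ if and only if there is a number $$t^*\in\left(\max\left\{-\frac{\alpha_2}{\sigma},0\right\},\,-\frac{\alpha_1}{\sigma}\right)$$ such that $h(t^*)=0$, $h'(t^*)>0$ and $x=-(\sigma t^*I+H)^{-1}c$, where $h(t)=\|(\sigma tI+H)^{-1}c\|^2-t^{2/(p-2)}$ for $t$ in this interval. (For $n=1$, where there is no $\alpha_2$, put $\alpha_2=+\infty$, so that the left endpoint is $0$; an interval whose left endpoint is not smaller than its right endpoint is empty. For $t$ in the interval the matrix $\sigma tI+H$ is invertible.) -/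

import Mathlib

noncomputable section

/-- The objective `g(x) = (1/2) xᵀHx + cᵀx + (σ/p) ‖x‖ ^ p` of the `p`-regularized subproblem,
on `ℝⁿ` with the Euclidean norm. -/
def pRS {n : ℕ} (H : Matrix (Fin n) (Fin n) ℝ) (c : EuclideanSpace ℝ (Fin n)) (σ p : ℝ)
    (x : EuclideanSpace ℝ (Fin n)) : ℝ :=
  1 / 2 * inner ℝ x (Matrix.toEuclideanLin H x) + inner ℝ c x + σ / p * ‖x‖ ^ p

/-- `x` is a local minimizer of `f`, but not a global one. -/
def IsLocalNonglobalMin {n : ℕ} (f : EuclideanSpace ℝ (Fin n) → ℝ)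
    (x : EuclideanSpace ℝ (Fin n)) : Prop :=
  IsLocalMin f x ∧ ¬ ∀ y, f x ≤ f y

/-- The eigenvalues of a real symmetric matrix, with multiplicity, in increasing order
(`Matrix.IsHermitian.eigenvalues₀` lists them in decreasing order).
The index `0` belongs to the smallest one, the index `1` to the second smallest. -/
def incEigenvalues {n : ℕ} {H : Matrix (Fin n) (Fin n) ℝ} (hH : H.IsHermitian) (i : Fin n) : ℝ :=
  hH.eigenvalues₀ (Fin.cast (Fintype.card_fin n).symm i.rev)

/-- `(σ t I + H)⁻¹ c`. -/
def resolventVec {n : ℕ} (H : Matrix (Fin n) (Fin n) ℝ) (c : EuclideanSpace ℝ (Fin n)) (σ t : ℝ) :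
    EuclideanSpace ℝ (Fin n) :=
  Matrix.toEuclideanLin ((σ * t) • (1 : Matrix (Fin n) (Fin n) ℝ) + H)⁻¹ c

/-- The secular function `h(t) = ‖(σ t I + H)⁻¹ c‖² - t ^ (2 / (p - 2))`. -/
def secular {n : ℕ} (H : Matrix (Fin n) (Fin n) ℝ) (c : EuclideanSpace ℝ (Fin n)) (σ p t : ℝ) : ℝ :=
  ‖resolventVec H c σ t‖ ^ 2 - t ^ (2 / (p - 2))

/-- The open interval `(max {-α₂ / σ, 0}, -α₁ / σ)`, where `α₁ ≤ α₂ ≤ … ≤ αₙ` are the eigenvalues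
of `H`. For `n = 1` there is no `α₂`: it is read as `+∞`, so that the left endpoint is `0`. -/
def secularInterval {n : ℕ} (hn : 1 ≤ n) {H : Matrix (Fin n) (Fin n) ℝ} (hH : H.IsHermitian)
    (σ : ℝ) : Set ℝ :=
  Set.Ioo (if h : 2 ≤ n then max (-incEigenvalues hH ⟨1, h⟩ / σ) 0 else 0)
    (-incEigenvalues hH ⟨0, hn⟩ / σ)

end

/-!
Write `A = H + σ t` with `t = ‖x‖ ^ (p - 2)`. A local minimizer `x` satisfies `A x = -c`, and then

  `g (x + d) - g x = ½ dᵀ A d + Φ (‖x + d‖ ^ 2)`,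

where `Φ` is a convex function of the squared norm which vanishes together with its derivative at
`‖x‖ ^ 2` (`objective_add_sub`). If `A` is positive semidefinite, `x` is therefore a global
minimizer. Otherwise `A` has a negative eigenvalue. The form is nonnegative on the hyperplane
orthogonal to `x` (`form_nonneg_of_isLocalMin`), and a motion along the sphere through `x`, where
`Φ` vanishes, shows that all other eigenvalues are strictly positive
(`pos_of_orthonormal_eigenvectors`). Hence `t` lies in the open interval of the theorem and `x`
lies on the curve `X (t) = -(H + σ t)⁻¹ c`, at a zero of the secular function `h`.

The delicate point of the necessity is the strict sign of the slope of `h`. Along the curve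
`d/dt g (X (t)) = ½ σ (‖X‖ ^ (p - 2) - t) (‖X‖ ^ 2)'`, and the first factor has the sign of `h`.
Each summand of `‖X (t)‖ ^ 2 t ^ (-q)`, `q = 2 / (p - 2)`, is strictly log-convex; so if the slope
of `h` at its zero `t₀` is not positive, `h` is positive to the left of `t₀`
(`rpow_lt_norm_sq_resolventCurve`). If `‖X‖ ^ 2` increases at `t₀`, then `g ∘ X` is strictly
increasing to the left of `t₀`; if it is stationary there, `g ∘ X` is strictly decreasing to the
right, because `(‖X‖ ^ 2)'` is strictly increasing. Both contradict local minimality, and a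
decreasing `‖X‖ ^ 2` contradicts the second-order condition (`inner_resolventCurve_nonneg`).

For sufficiency, put `y = X' (t)`, so that `A y = -σ x`; a positive slope of `h` says that
`2⟪x, y⟫ > q t ^ (q - 1)`. The form of `A` is negative at `y`, and reflecting `x` on its sphere
along `y` gives a smaller value, so `x` is not global (`not_isGlobalMin_of_form_neg`). The bound
on `⟪x, y⟫` also says that adding `κ x xᵀ` to `A` repairs its only negative direction for some `κ`
below the radial curvature `σ (p - 2) ‖x‖ ^ (p - 4)` (`form_add_pos`), which is the second-order
sufficient condition (`isLocalMin_of_form_pos`).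
-/

open Filter Topology

namespace PRegularized

/-! ### Calculus of the objective and its first-order condition -/

section Objective

lemma norm_rpow_eq_sq_rpow {E : Type*} [NormedAddCommGroup E] (x : E) (r : ℝ) :
    ‖x‖ ^ r = (‖x‖ ^ 2) ^ (r / 2) := by
  rw [← Real.rpow_natCast, ← Real.rpow_mul (norm_nonneg x)]
  congr 1
  push_cast
  ring

variable {E : Type*} [NormedAddCommGroup E] [InnerProductSpace ℝ E]

/-- The objective `½⟪y, T y⟫ + ⟪c, y⟫ + (σ / p) ‖y‖ ^ p` for a linear operator `T`. -/
noncomputable def objective (T : E →ₗ[ℝ] E) (c : E) (σ p : ℝ) (y : E) : ℝ :=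
  1 / 2 * inner ℝ y (T y) + inner ℝ c y + σ / p * ‖y‖ ^ p

variable {T : E →ₗ[ℝ] E} {c : E} {σ p : ℝ}

/-- The chain rule along a curve; the covector is the gradient `T x + c + σ ‖x‖ ^ (p - 2) x`. -/
lemma hasDerivAt_objective_comp [FiniteDimensional ℝ E] (hT : T.IsSymmetric) (hp : 2 < p)
    {X : ℝ → E} {X' : E} {s : ℝ} (hX : HasDerivAt X X' s) :
    HasDerivAt (fun r => objective T c σ p (X r))
      (inner ℝ (T (X s) + c + (σ * ‖X s‖ ^ (p - 2)) • X s) X') s := by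
  have hTX : HasDerivAt (fun r => T (X r)) (T X') s :=
    (LinearMap.toContinuousLinearMap T).hasFDerivAt.comp_hasDerivAt s hX
  have h1 := (hX.inner ℝ hTX).const_mul (1 / 2 : ℝ)
  have h2 := (hasDerivAt_const s c).inner ℝ hX
  have h3 := ((hX.norm_sq).rpow_const (p := p / 2) (Or.inr (by linarith))).const_mul (σ / p)
  have h := (h1.add h2).add h3
  refine (h.congr_deriv ?_).congr_of_eventuallyEq (Eventually.of_forall fun r => ?_)
  · have e1 : inner ℝ (X s) (T X') = inner ℝ (T (X s)) X' := (hT _ _).symm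
    have e2 : inner ℝ X' (T (X s)) = inner ℝ (T (X s)) X' := real_inner_comm _ _
    have e3 : (‖X s‖ ^ 2) ^ (p / 2 - 1) = ‖X s‖ ^ (p - 2) := by
      rw [norm_rpow_eq_sq_rpow (X s) (p - 2)]; congr 1; ring
    rw [inner_add_left, inner_add_left, real_inner_smul_left, e1, e2, e3]
    have : p ≠ 0 := by linarith
    simp only [inner_zero_left]
    field_simp
    ring
  · simp only [objective, Pi.add_apply]
    rw [norm_rpow_eq_sq_rpow (X r) p]

lemma gradient_eq_zero_of_isLocalMin [FiniteDimensional ℝ E] (hT : T.IsSymmetric) (hp : 2 < p)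
    {x : E} (hx : IsLocalMin (objective T c σ p) x) :
    T x + c + (σ * ‖x‖ ^ (p - 2)) • x = 0 := by
  set v := T x + c + (σ * ‖x‖ ^ (p - 2)) • x with hv
  have hX : HasDerivAt (fun s : ℝ => x + s • v) v 0 := by
    simpa using ((hasDerivAt_id (0 : ℝ)).smul_const v).const_add x
  have hd := hasDerivAt_objective_comp (T := T) (c := c) (σ := σ) hT hp hX
  have hmin : IsLocalMin (fun s : ℝ => objective T c σ p (x + s • v)) 0 := by
    have hcont : Tendsto (fun s : ℝ => x + s • v) (𝓝 0) (𝓝 x) := by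
      simpa using hX.continuousAt.tendsto
    filter_upwards [hcont.eventually hx] with s hs
    simpa using hs
  have h0 := hmin.hasDerivAt_eq_zero hd
  simp only [zero_smul, add_zero, ← hv] at h0
  exact inner_self_eq_zero.mp h0

/-- At a stationary point `x` the increment of the objective splits into the quadratic form of
`T + σ ‖x‖ ^ (p - 2)` and a function of the increment of `‖·‖ ^ 2` alone. -/
lemma objective_add_sub (hT : T.IsSymmetric) (hp : 2 < p) {x : E}
    (hx : T x + c + (σ * ‖x‖ ^ (p - 2)) • x = 0) (d : E) :
    objective T c σ p (x + d) - objective T c σ p x =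
      1 / 2 * (inner ℝ d (T d) + σ * ‖x‖ ^ (p - 2) * ‖d‖ ^ 2) +
      σ / p * ((‖x + d‖ ^ 2) ^ (p / 2) - (‖x‖ ^ 2) ^ (p / 2)
        - p / 2 * ‖x‖ ^ (p - 2) * (‖x + d‖ ^ 2 - ‖x‖ ^ 2)) := by
  have hc : c = -(T x) - (σ * ‖x‖ ^ (p - 2)) • x := by
    rw [← sub_eq_zero, ← hx]; abel
  have e1 : inner ℝ x (T d) = inner ℝ (T x) d := (hT _ _).symm
  have e2 : inner ℝ d (T x) = inner ℝ (T x) d := real_inner_comm _ _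
  have e3 : inner ℝ c d = -inner ℝ (T x) d - σ * ‖x‖ ^ (p - 2) * inner ℝ x d := by
    rw [hc, inner_sub_left, inner_neg_left, real_inner_smul_left]
  have e4 : ‖x + d‖ ^ 2 = ‖x‖ ^ 2 + 2 * inner ℝ x d + ‖d‖ ^ 2 := norm_add_sq_real x d
  simp only [objective, norm_rpow_eq_sq_rpow _ p, map_add, inner_add_left, inner_add_right,
    e1, e2, e3]
  rw [e4]
  have : p ≠ 0 := by linarith
  field_simp
  ring

/-- Along the sphere through a stationary point the objective is a quadratic form. -/
lemma objective_add_sub_of_norm_eq (hT : T.IsSymmetric) (hp : 2 < p) {x : E}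
    (hx : T x + c + (σ * ‖x‖ ^ (p - 2)) • x = 0) {d : E} (hd : ‖x + d‖ ^ 2 = ‖x‖ ^ 2) :
    objective T c σ p (x + d) - objective T c σ p x =
      1 / 2 * (inner ℝ d (T d) + σ * ‖x‖ ^ (p - 2) * ‖d‖ ^ 2) := by
  rw [objective_add_sub hT hp hx, hd]
  ring

/-- The graph of `u ↦ u ^ r` lies above its tangents. -/
lemma rpow_tangent_le {r a u : ℝ} (hr : 1 < r) (ha : 0 ≤ a) (hu : 0 ≤ u) :
    a ^ r + r * a ^ (r - 1) * (u - a) ≤ u ^ r := by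
  rcases ha.eq_or_lt with rfl | ha
  · rw [Real.zero_rpow (by linarith), Real.zero_rpow (by linarith)]
    simpa using Real.rpow_nonneg hu r
  · have h := one_add_mul_self_le_rpow_one_add (s := u / a - 1)
      (by have := div_nonneg hu ha.le; linarith) hr.le
    have e : (1 + (u / a - 1)) ^ r = u ^ r / a ^ r := by
      rw [← Real.div_rpow hu ha.le]; congr 1; ring
    have hpos : 0 < a ^ r := Real.rpow_pos_of_pos ha r
    rw [e, le_div_iff₀ hpos] at h
    rw [Real.rpow_sub ha, Real.rpow_one]
    calc _ = (1 + r * (u / a - 1)) * a ^ r := by field_simp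
      _ ≤ _ := h

lemma isGlobalMin_of_form_nonneg (hT : T.IsSymmetric) (hp : 2 < p) (hσ : 0 < σ) {x : E}
    (hx : T x + c + (σ * ‖x‖ ^ (p - 2)) • x = 0)
    (hA : ∀ d : E, 0 ≤ inner ℝ d (T d) + σ * ‖x‖ ^ (p - 2) * ‖d‖ ^ 2) (y : E) :
    objective T c σ p x ≤ objective T c σ p y := by
  have h := objective_add_sub hT hp hx (y - x)
  have h1 := rpow_tangent_le (r := p / 2) (by linarith) (sq_nonneg ‖x‖) (sq_nonneg ‖x + (y - x)‖)
  have e : (‖x‖ ^ 2) ^ (p / 2 - 1) = ‖x‖ ^ (p - 2) := by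
    rw [norm_rpow_eq_sq_rpow x (p - 2)]; congr 1; ring
  rw [e] at h1
  have h2 : 0 ≤ σ / p * ((‖x + (y - x)‖ ^ 2) ^ (p / 2) - (‖x‖ ^ 2) ^ (p / 2)
        - p / 2 * ‖x‖ ^ (p - 2) * (‖x + (y - x)‖ ^ 2 - ‖x‖ ^ 2)) :=
    mul_nonneg (div_nonneg hσ.le (by linarith)) (by linarith)
  have h3 := hA (y - x)
  rw [add_sub_cancel] at h h2
  linarith

/-! ### Second-order conditions at a local minimizer -/

/-- The second-order necessary condition in the directions tangent to the sphere through `x`.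
For `x = 0` these are all directions. -/
lemma form_nonneg_of_isLocalMin [FiniteDimensional ℝ E] (hT : T.IsSymmetric) (hp : 2 < p) {x : E}
    (hx : IsLocalMin (objective T c σ p) x) {u : E} (hu : inner ℝ x u = 0) :
    0 ≤ inner ℝ u (T u) + σ * ‖x‖ ^ (p - 2) * ‖u‖ ^ 2 := by
  by_contra! hneg
  have hst := gradient_eq_zero_of_isLocalMin hT hp hx
  set q := inner ℝ u (T u) + σ * ‖x‖ ^ (p - 2) * ‖u‖ ^ 2 with hq
  set a := ‖x‖ ^ 2
  set m := ‖u‖ ^ 2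
  -- The increment of the objective at `x + √r u`, as a function of `r`; its slope at `0` is `q / 2`.
  let ψ : ℝ → ℝ := fun r => 1 / 2 * (r * q) +
    σ / p * ((a + r * m) ^ (p / 2) - a ^ (p / 2) - p / 2 * ‖x‖ ^ (p - 2) * (r * m))
  have hψ : HasDerivAt ψ (1 / 2 * q) 0 := by
    have h1 : HasDerivAt (fun r : ℝ => r * q) q 0 := by
      simpa using (hasDerivAt_id (0 : ℝ)).mul_const q
    have h2 : HasDerivAt (fun r : ℝ => r * m) m 0 := by
      simpa using (hasDerivAt_id (0 : ℝ)).mul_const m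
    have h3 := (h2.const_add a).rpow_const (p := p / 2) (Or.inr (by linarith))
    have h4 := (h1.const_mul (1 / 2)).add
      (((h3.sub_const (a ^ (p / 2))).sub (h2.const_mul (p / 2 * ‖x‖ ^ (p - 2)))).const_mul (σ / p))
    refine (h4.congr_deriv ?_)
    have e : (a + 0 * m) ^ (p / 2 - 1) = ‖x‖ ^ (p - 2) := by
      rw [norm_rpow_eq_sq_rpow x (p - 2), zero_mul, add_zero]; congr 1; ring
    rw [e]
    ring
  have hψ0 : ψ 0 = 0 := by simp [ψ]
  have hsign := eventually_nhdsWithin_sign_eq_of_deriv_neg (f := ψ) (x₀ := 0)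
    (by rw [hψ.deriv]; linarith) hψ0
  have hcont : Tendsto (fun r : ℝ => x + √r • u) (𝓝[>] 0) (𝓝 x) := by
    have : Continuous fun r : ℝ => x + √r • u := by fun_prop
    simpa using (this.tendsto 0).mono_left nhdsWithin_le_nhds
  have hev := hcont.eventually hx
  have hsign' := hsign.filter_mono (nhdsWithin_le_nhds (s := Set.Ioi (0 : ℝ)))
  obtain ⟨r, ⟨hr1, hr2⟩, hr0⟩ := ((hev.and hsign').and self_mem_nhdsWithin).exists
  have hr0 : 0 < r := hr0
  have hneg' : ψ r < 0 := by
    rw [zero_sub, Left.sign_neg, sign_pos hr0] at hr2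
    exact sign_eq_neg_one_iff.mp hr2
  have hinc := objective_add_sub hT hp hst (√r • u)
  have hn : ‖x + √r • u‖ ^ 2 = a + r * m := by
    rw [norm_add_sq_real, real_inner_smul_right, hu, norm_smul, mul_pow, Real.norm_eq_abs,
      sq_abs, Real.sq_sqrt hr0.le]
    ring
  have hn2 : ‖√r • u‖ ^ 2 = r * m := by
    rw [norm_smul, mul_pow, Real.norm_eq_abs, sq_abs, Real.sq_sqrt hr0.le]
  have hn3 : inner ℝ (√r • u) (T (√r • u)) = r * inner ℝ u (T u) := by
    rw [map_smul, real_inner_smul_left, real_inner_smul_right, ← mul_assoc,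
      Real.mul_self_sqrt hr0.le]
  rw [hn, hn2, hn3] at hinc
  have : objective T c σ p (x + √r • u) - objective T c σ p x = ψ r := by
    rw [hinc]; simp only [ψ, hq]; ring
  linarith

/-- At a local minimizer the shifted operator has no two orthonormal eigenvectors with a negative
and a nonpositive eigenvalue: in the plane they span, the circle of points of norm `‖x‖` carries
points arbitrarily close to `x` with smaller values. -/
lemma pos_of_orthonormal_eigenvectors [FiniteDimensional ℝ E] (hT : T.IsSymmetric) (hp : 2 < p)
    {x : E} (hx : IsLocalMin (objective T c σ p) x) {e f : E} (he : ‖e‖ = 1) (hf : ‖f‖ = 1)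
    (hef : inner ℝ e f = 0) {α β : ℝ} (hTe : T e = α • e) (hTf : T f = β • f)
    (hα : α + σ * ‖x‖ ^ (p - 2) < 0) : 0 < β + σ * ‖x‖ ^ (p - 2) := by
  by_contra! hβ
  have hst := gradient_eq_zero_of_isLocalMin hT hp hx
  set τ := σ * ‖x‖ ^ (p - 2) with hτ
  have hfe : inner ℝ f e = 0 := by rw [real_inner_comm, hef]
  have hee : inner ℝ e e = 1 := by rw [real_inner_self_eq_norm_sq, he, one_pow]
  have hff : inner ℝ f f = 1 := by rw [real_inner_self_eq_norm_sq, hf, one_pow]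
  have hform (a b : ℝ) : inner ℝ (a • e + b • f) (T (a • e + b • f)) + τ * ‖a • e + b • f‖ ^ 2 =
      (α + τ) * a ^ 2 + (β + τ) * b ^ 2 := by
    rw [← real_inner_self_eq_norm_sq]
    simp only [map_add, map_smul, hTe, hTf, inner_add_left, inner_add_right, real_inner_smul_left,
      real_inner_smul_right, hef, hfe, hee, hff]
    ring
  have hnorm (a b : ℝ) : ‖a • e + b • f‖ ^ 2 = a ^ 2 + b ^ 2 := by
    rw [← real_inner_self_eq_norm_sq]
    simp only [inner_add_left, inner_add_right, real_inner_smul_left,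
      real_inner_smul_right, hef, hfe, hee, hff]
    ring
  set x1 := inner ℝ x e with hx1
  set x2 := inner ℝ x f with hx2
  have hin (a b : ℝ) : inner ℝ x (a • e + b • f) = a * x1 + b * x2 := by
    rw [inner_add_right, real_inner_smul_right, real_inner_smul_right]
  have hx1ne : x1 ≠ 0 := by
    intro h0
    have h := form_nonneg_of_isLocalMin hT hp hx (u := (1 : ℝ) • e + (0 : ℝ) • f)
      (by rw [hin, h0]; ring)
    rw [hform] at h
    linarith
  have hx20 : x2 = 0 := by
    have h := form_nonneg_of_isLocalMin hT hp hx (u := x2 • e + (-x1) • f)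
      (by rw [hin]; ring)
    rw [hform] at h
    by_contra h0
    have h1 : 0 < x2 ^ 2 := by positivity
    nlinarith [mul_pos_of_neg_of_neg hα (neg_lt_zero.mpr h1), sq_nonneg x1]
  -- The points of the circle, parametrized by the displacement `-s x1` along `e`.
  let D : ℝ → E := fun s => (-s * x1) • e + (x1 * √(2 * s - s ^ 2)) • f
  have hcont : Tendsto (fun s => x + D s) (𝓝[>] 0) (𝓝 x) := by
    have : Continuous fun s => x + D s := by simp only [D]; fun_prop
    simpa [D] using (this.tendsto 0).mono_left nhdsWithin_le_nhds
  have hlt : ∀ᶠ s : ℝ in 𝓝[>] 0, s < 1 :=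
    (eventually_lt_nhds (zero_lt_one)).filter_mono nhdsWithin_le_nhds
  obtain ⟨s, ⟨hs1, hs2⟩, hs0⟩ := ((hcont.eventually hx).and hlt |>.and self_mem_nhdsWithin).exists
  have hs0 : 0 < s := hs0
  have hsq : √(2 * s - s ^ 2) ^ 2 = 2 * s - s ^ 2 := Real.sq_sqrt (by nlinarith)
  have hsphere : ‖x + D s‖ ^ 2 = ‖x‖ ^ 2 := by
    rw [norm_add_sq_real, hnorm, hin, hx20, mul_pow x1, hsq]
    ring
  have hval := objective_add_sub_of_norm_eq hT hp hst hsphere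
  rw [← hτ, hform] at hval
  have hne : -s * x1 ≠ 0 := mul_ne_zero (neg_ne_zero.mpr hs0.ne') hx1ne
  have h1 : (α + τ) * (-s * x1) ^ 2 < 0 := mul_neg_of_neg_of_pos hα (by positivity)
  have h2 : (β + τ) * (x1 * √(2 * s - s ^ 2)) ^ 2 ≤ 0 :=
    mul_nonpos_of_nonpos_of_nonneg hβ (sq_nonneg _)
  linarith

end Objective

/-! ### The curve of stationary points of the shifted quadratics -/

section Curve

variable {E : Type*} [NormedAddCommGroup E] [InnerProductSpace ℝ E] {ι : Type*} [Fintype ι]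

/-- The point `-(T + σ t)⁻¹ c`, written in an orthonormal eigenbasis `b` of `T` with
eigenvalues `α`. -/
noncomputable def resolventCurve (b : OrthonormalBasis ι ℝ E) (α : ι → ℝ) (c : E) (σ t : ℝ) : E :=
  ∑ i, (-inner ℝ (b i) c / (α i + σ * t)) • b i

/-- The velocity of `resolventCurve` in `t`. -/
noncomputable def resolventCurveDeriv (b : OrthonormalBasis ι ℝ E) (α : ι → ℝ) (c : E)
    (σ t : ℝ) : E :=
  ∑ i, (σ * inner ℝ (b i) c / (α i + σ * t) ^ 2) • b i

variable {T : E →ₗ[ℝ] E} {b : OrthonormalBasis ι ℝ E} {α : ι → ℝ} {c : E} {σ p t : ℝ}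

lemma inner_basis_sum (f : ι → ℝ) (i : ι) : inner ℝ (b i) (∑ j, f j • b j) = f i := by
  classical
  simp [inner_sum, real_inner_smul_right, b.inner_eq_ite]

lemma norm_sq_basis_sum (f : ι → ℝ) : ‖∑ j, f j • b j‖ ^ 2 = ∑ j, f j ^ 2 := by
  rw [← b.sum_sq_norm_inner_right]
  simp [inner_basis_sum]

lemma ext_inner_basis {x y : E} (h : ∀ i, inner ℝ (b i) x = inner ℝ (b i) y) : x = y := by
  rw [← b.sum_repr' x, ← b.sum_repr' y]
  simp [h]

lemma inner_basis_apply (hT : T.IsSymmetric) (hb : ∀ i, T (b i) = α i • b i) (i : ι) (x : E) :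
    inner ℝ (b i) (T x) = α i * inner ℝ (b i) x := by
  rw [← hT, hb, real_inner_smul_left]

lemma resolventCurve_stationary (hT : T.IsSymmetric) (hb : ∀ i, T (b i) = α i • b i)
    (hs : ∀ i, α i + σ * t ≠ 0) :
    T (resolventCurve b α c σ t) + c + (σ * t) • resolventCurve b α c σ t = 0 := by
  refine ext_inner_basis (b := b) fun i => ?_
  rw [inner_add_right, inner_add_right, inner_basis_apply hT hb, real_inner_smul_right,
    resolventCurve, inner_basis_sum, inner_zero_right]
  have := hs i
  field_simp
  ring

lemma eq_resolventCurve_of_stationary (hT : T.IsSymmetric) (hb : ∀ i, T (b i) = α i • b i)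
    (hs : ∀ i, α i + σ * t ≠ 0) {x : E} (hx : T x + c + (σ * t) • x = 0) :
    x = resolventCurve b α c σ t := by
  refine ext_inner_basis (b := b) fun i => ?_
  have h := congrArg (inner ℝ (b i)) hx
  rw [inner_add_right, inner_add_right, inner_basis_apply hT hb, real_inner_smul_right,
    inner_zero_right] at h
  rw [resolventCurve, inner_basis_sum, eq_div_iff (hs i)]
  linarith

/-- The stationarity equation of `resolventCurve`, differentiated in `t`. -/
lemma apply_resolventCurveDeriv (hT : T.IsSymmetric) (hb : ∀ i, T (b i) = α i • b i)
    (hs : ∀ i, α i + σ * t ≠ 0) :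
    T (resolventCurveDeriv b α c σ t) + (σ * t) • resolventCurveDeriv b α c σ t =
      -σ • resolventCurve b α c σ t := by
  refine ext_inner_basis (b := b) fun i => ?_
  rw [inner_add_right, inner_basis_apply hT hb, real_inner_smul_right, real_inner_smul_right,
    resolventCurve, resolventCurveDeriv, inner_basis_sum, inner_basis_sum]
  have := hs i
  field_simp

lemma hasDerivAt_resolventCurve (hs : ∀ i, α i + σ * t ≠ 0) :
    HasDerivAt (resolventCurve b α c σ) (resolventCurveDeriv b α c σ t) t := by
  unfold resolventCurve resolventCurveDeriv
  refine HasDerivAt.fun_sum fun i _ => HasDerivAt.smul_const ?_ _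
  have h1 : HasDerivAt (fun r : ℝ => α i + σ * r) σ t := by
    simpa using ((hasDerivAt_id t).const_mul σ).const_add (α i)
  refine ((hasDerivAt_const t (-inner ℝ (b i) c)).div h1 (hs i)).congr_deriv ?_
  ring

lemma norm_sq_resolventCurve (t : ℝ) :
    ‖resolventCurve b α c σ t‖ ^ 2 = ∑ i, inner ℝ (b i) c ^ 2 / (α i + σ * t) ^ 2 := by
  rw [resolventCurve, norm_sq_basis_sum]
  simp [div_pow]

lemma two_mul_inner_resolventCurve (hs : ∀ i, α i + σ * t ≠ 0) :
    2 * inner ℝ (resolventCurve b α c σ t) (resolventCurveDeriv b α c σ t) =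
      ∑ i, -2 * σ * inner ℝ (b i) c ^ 2 / (α i + σ * t) ^ 3 := by
  rw [← b.sum_inner_mul_inner, Finset.mul_sum]
  refine Finset.sum_congr rfl fun i _ => ?_
  rw [real_inner_comm, resolventCurve, resolventCurveDeriv, inner_basis_sum, inner_basis_sum]
  have := hs i
  field_simp

/-- Along the curve the gradient of the objective is a multiple of the position vector, so that the
objective moves in the direction given by the signs of `‖x‖ ^ (p - 2) - t` and of the derivative of
`‖x‖ ^ 2`. -/
lemma hasDerivAt_objective_resolventCurve [FiniteDimensional ℝ E] (hT : T.IsSymmetric) (hp : 2 < p)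
    (hb : ∀ i, T (b i) = α i • b i) (hs : ∀ i, α i + σ * t ≠ 0) :
    HasDerivAt (fun r => objective T c σ p (resolventCurve b α c σ r))
      (σ * (‖resolventCurve b α c σ t‖ ^ (p - 2) - t) *
        inner ℝ (resolventCurve b α c σ t) (resolventCurveDeriv b α c σ t)) t := by
  refine (hasDerivAt_objective_comp hT hp (hasDerivAt_resolventCurve hs)).congr_deriv ?_
  have h := resolventCurve_stationary (c := c) hT hb hs
  rw [← real_inner_smul_left]
  congr 1
  rw [← sub_eq_zero, ← h]
  module

/-- The product `r⁻² τ^(-q)` is strictly log-convex, hence lies strictly above its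
tangent at `(1, 1)`. -/
lemma tangent_lt_of_logConvex {r τ q : ℝ} (hr : 0 < r) (hτ : 0 < τ) (hτ1 : τ ≠ 1) (hq : 0 < q) :
    1 - 2 * (r - 1) - q * (τ - 1) < (r ^ 2)⁻¹ * (τ ^ q)⁻¹ := by
  have h1 := Real.log_le_sub_one_of_pos hr
  have h2 := Real.log_lt_sub_one_of_pos hτ hτ1
  have h3 := Real.add_one_le_exp (-(2 * Real.log r) - Real.log τ * q)
  have e1 : Real.exp (-(2 * Real.log r) - Real.log τ * q) = (r ^ 2)⁻¹ * (τ ^ q)⁻¹ := by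
    rw [sub_eq_add_neg, Real.exp_add, Real.exp_neg, Real.exp_neg, Real.rpow_def_of_pos hτ,
      two_mul, Real.exp_add, Real.exp_log hr, sq]
  rw [e1] at h3
  nlinarith

/-- If the secular function has a zero at `t₀` and a nonpositive slope there, then it is positive to
the left of `t₀`, as long as no eigenvalue of `T + σ t` changes its sign: divided by `t ^ q`, the
squared norm of the curve is a strictly convex function of `t`. -/
lemma rpow_lt_norm_sq_resolventCurve {q t₀ : ℝ} (hq : 0 < q) (ht : 0 < t) (htt : t < t₀)
    (hs : ∀ i, 0 < (α i + σ * t₀) * (α i + σ * t))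
    (h0 : ‖resolventCurve b α c σ t₀‖ ^ 2 = t₀ ^ q)
    (h1 : 2 * inner ℝ (resolventCurve b α c σ t₀) (resolventCurveDeriv b α c σ t₀)
      ≤ q * t₀ ^ (q - 1)) :
    t ^ q < ‖resolventCurve b α c σ t‖ ^ 2 := by
  have ht0 : 0 < t₀ := ht.trans htt
  have hs0 (i) : α i + σ * t₀ ≠ 0 := left_ne_zero_of_mul (hs i).ne'
  have hst (i) : α i + σ * t ≠ 0 := right_ne_zero_of_mul (hs i).ne'
  have htq0 : 0 < t₀ ^ q := Real.rpow_pos_of_pos ht0 q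
  have htq : 0 < t ^ q := Real.rpow_pos_of_pos ht q
  rw [two_mul_inner_resolventCurve hs0] at h1
  rw [norm_sq_resolventCurve] at h0 ⊢
  -- The tangent inequality for the summand of index `i`.
  have key (i) : 1 - 2 * σ * (t - t₀) / (α i + σ * t₀) - q * (t / t₀ - 1) <
      (α i + σ * t₀) ^ 2 / (α i + σ * t) ^ 2 * (t₀ ^ q / t ^ q) := by
    have hr : 0 < (α i + σ * t) / (α i + σ * t₀) := by
      rcases pos_and_pos_or_neg_and_neg_of_mul_pos (hs i) with ⟨h, h'⟩ | ⟨h, h'⟩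
      · exact div_pos h' h
      · exact div_pos_of_neg_of_neg h' h
    have h := tangent_lt_of_logConvex hr (div_pos ht ht0) ((div_lt_one ht0).mpr htt).ne hq
    rw [Real.div_rpow ht.le ht0.le, inv_div, div_pow, inv_div] at h
    convert h using 3
    have := hs0 i
    field_simp
    ring
  obtain ⟨j, -, hj⟩ : ∃ j ∈ Finset.univ, inner ℝ (b j) c ^ 2 / (α j + σ * t₀) ^ 2 ≠ 0 :=
    Finset.exists_ne_zero_of_sum_ne_zero (by rw [h0]; exact htq0.ne')
  have hsum : ∑ i, inner ℝ (b i) c ^ 2 / (α i + σ * t₀) ^ 2 *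
        (1 - 2 * σ * (t - t₀) / (α i + σ * t₀) - q * (t / t₀ - 1)) <
      ∑ i, inner ℝ (b i) c ^ 2 / (α i + σ * t₀) ^ 2 *
        ((α i + σ * t₀) ^ 2 / (α i + σ * t) ^ 2 * (t₀ ^ q / t ^ q)) := by
    refine Finset.sum_lt_sum (fun i _ => mul_le_mul_of_nonneg_left (key i).le (by positivity))
      ⟨j, Finset.mem_univ j, mul_lt_mul_of_pos_left (key j) ?_⟩
    exact lt_of_le_of_ne (by positivity) hj.symm
  have eL : ∑ i, inner ℝ (b i) c ^ 2 / (α i + σ * t₀) ^ 2 *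
        (1 - 2 * σ * (t - t₀) / (α i + σ * t₀) - q * (t / t₀ - 1)) =
      (1 - q * (t / t₀ - 1)) * t₀ ^ q +
        (t - t₀) * ∑ i, -2 * σ * inner ℝ (b i) c ^ 2 / (α i + σ * t₀) ^ 3 := by
    rw [← h0, Finset.mul_sum, Finset.mul_sum, ← Finset.sum_add_distrib]
    refine Finset.sum_congr rfl fun i _ => ?_
    have := hs0 i
    field_simp
    ring
  have eR : ∑ i, inner ℝ (b i) c ^ 2 / (α i + σ * t₀) ^ 2 *
        ((α i + σ * t₀) ^ 2 / (α i + σ * t) ^ 2 * (t₀ ^ q / t ^ q)) =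
      (∑ i, inner ℝ (b i) c ^ 2 / (α i + σ * t) ^ 2) * (t₀ ^ q / t ^ q) := by
    rw [Finset.sum_mul]
    refine Finset.sum_congr rfl fun i _ => ?_
    have := hs0 i
    have := hst i
    field_simp
  rw [eL, eR] at hsum
  have h2 : (t - t₀) * (q * t₀ ^ (q - 1)) ≤
      (t - t₀) * ∑ i, -2 * σ * inner ℝ (b i) c ^ 2 / (α i + σ * t₀) ^ 3 :=
    mul_le_mul_of_nonpos_left h1 (by linarith)
  have e3 : (t - t₀) * (q * t₀ ^ (q - 1)) = q * (t / t₀ - 1) * t₀ ^ q := by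
    rw [Real.rpow_sub ht0, Real.rpow_one]
    field_simp
  have h3 : t₀ ^ q < (∑ i, inner ℝ (b i) c ^ 2 / (α i + σ * t) ^ 2) * (t₀ ^ q / t ^ q) := by
    linarith
  rw [mul_div_assoc', lt_div_iff₀ htq, mul_comm] at h3
  exact lt_of_mul_lt_mul_right h3 htq0.le

/-- The derivative of the squared norm of the curve is strictly increasing in `t`. -/
lemma inner_resolventCurve_lt {t₀ : ℝ} (hσ : 0 < σ) (htt : t₀ < t)
    (hs : ∀ i, 0 < (α i + σ * t₀) * (α i + σ * t)) (hx : resolventCurve b α c σ t₀ ≠ 0) :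
    inner ℝ (resolventCurve b α c σ t₀) (resolventCurveDeriv b α c σ t₀) <
      inner ℝ (resolventCurve b α c σ t) (resolventCurveDeriv b α c σ t) := by
  have hs0 (i) : α i + σ * t₀ ≠ 0 := left_ne_zero_of_mul (hs i).ne'
  have hst (i) : α i + σ * t ≠ 0 := right_ne_zero_of_mul (hs i).ne'
  refine lt_of_mul_lt_mul_left ?_ (zero_le_two (α := ℝ))
  rw [two_mul_inner_resolventCurve hs0, two_mul_inner_resolventCurve hst]
  have key (i) : ((α i + σ * t) ^ 3)⁻¹ < ((α i + σ * t₀) ^ 3)⁻¹ := by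
    have h1 : (α i + σ * t₀) ^ 3 < (α i + σ * t) ^ 3 :=
      Odd.strictMono_pow (by decide) (by nlinarith)
    rcases pos_and_pos_or_neg_and_neg_of_mul_pos (hs i) with ⟨h, h'⟩ | ⟨h, h'⟩
    · exact inv_strictAnti₀ (by positivity) h1
    · exact (inv_lt_inv_of_neg (Odd.pow_neg (by decide) h') (Odd.pow_neg (by decide) h)).mpr h1
  obtain ⟨j, hj⟩ : ∃ j, inner ℝ (b j) c ≠ 0 := by
    by_contra! h
    exact hx (by simp [resolventCurve, h])
  have e (i) (s : ℝ) : -2 * σ * inner ℝ (b i) c ^ 2 / s =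
      (2 * σ * inner ℝ (b i) c ^ 2) * (-s⁻¹) := by
    rw [div_eq_mul_inv]; ring
  simp only [e]
  refine Finset.sum_lt_sum (fun i _ => mul_le_mul_of_nonneg_left ?_ (by positivity))
    ⟨j, Finset.mem_univ j, mul_lt_mul_of_pos_left ?_ (by positivity)⟩
  · exact neg_le_neg (key i).le
  · exact neg_lt_neg (key j)

/-! ### The slope of the secular function at a local minimizer -/

lemma eventually_lt_of_deriv_pos_left {φ φ' : ℝ → ℝ} {a : ℝ}
    (hd : ∀ᶠ s in 𝓝 a, HasDerivAt φ (φ' s) s) (hpos : ∀ᶠ s in 𝓝[<] a, 0 < φ' s) :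
    ∀ᶠ s in 𝓝[<] a, φ s < φ a := by
  obtain ⟨l, hl, hI⟩ := mem_nhdsLT_iff_exists_Ioo_subset.mp
    (hpos.and (hd.filter_mono nhdsWithin_le_nhds))
  have hmono : StrictMonoOn φ (Set.Ioc l a) := by
    refine strictMonoOn_of_deriv_pos (convex_Ioc l a) (fun s hs => ?_) fun s hs => ?_
    · rcases hs.2.eq_or_lt with rfl | h
      · exact hd.self_of_nhds.continuousAt.continuousWithinAt
      · exact (hI ⟨hs.1, h⟩).2.continuousAt.continuousWithinAt
    · rw [interior_Ioc] at hs
      rw [(hI hs).2.deriv]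
      exact (hI hs).1
  filter_upwards [Ioo_mem_nhdsLT hl] with s hs
  exact hmono ⟨hs.1, hs.2.le⟩ ⟨hl, le_rfl⟩ hs.2

lemma eventually_lt_of_deriv_neg_right {φ φ' : ℝ → ℝ} {a : ℝ}
    (hd : ∀ᶠ s in 𝓝 a, HasDerivAt φ (φ' s) s) (hneg : ∀ᶠ s in 𝓝[>] a, φ' s < 0) :
    ∀ᶠ s in 𝓝[>] a, φ s < φ a := by
  obtain ⟨l, hl, hI⟩ := mem_nhdsGT_iff_exists_Ioo_subset.mp
    (hneg.and (hd.filter_mono nhdsWithin_le_nhds))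
  have hanti : StrictAntiOn φ (Set.Ico a l) := by
    refine strictAntiOn_of_deriv_neg (convex_Ico a l) (fun s hs => ?_) fun s hs => ?_
    · rcases hs.1.eq_or_lt with rfl | h
      · exact hd.self_of_nhds.continuousAt.continuousWithinAt
      · exact (hI ⟨h, hs.2⟩).2.continuousAt.continuousWithinAt
    · rw [interior_Ico] at hs
      rw [(hI hs).2.deriv]
      exact (hI hs).1
  filter_upwards [Ioo_mem_nhdsGT hl] with s hs
  exact hanti ⟨le_rfl, hl⟩ ⟨hs.1.le, hs.2⟩ hs.1

/-- Near `t₀` the eigenvalues of `T + σ t` keep their signs. -/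
lemma eventually_sign_eq {t₀ : ℝ} (hs : ∀ i, α i + σ * t₀ ≠ 0) :
    ∀ᶠ t in 𝓝 t₀, ∀ i, 0 < (α i + σ * t₀) * (α i + σ * t) := by
  refine eventually_all.mpr fun i => ?_
  have hc : Continuous fun t => (α i + σ * t₀) * (α i + σ * t) := by fun_prop
  exact hc.continuousAt.eventually (lt_mem_nhds (mul_self_pos.mpr (hs i)))

lemma hasDerivAt_norm_sq_sub_rpow {q : ℝ} (ht : 0 < t) (hs : ∀ i, α i + σ * t ≠ 0) :
    HasDerivAt (fun r => ‖resolventCurve b α c σ r‖ ^ 2 - r ^ q)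
      (2 * inner ℝ (resolventCurve b α c σ t) (resolventCurveDeriv b α c σ t)
        - q * t ^ (q - 1)) t :=
  (hasDerivAt_resolventCurve hs).norm_sq.sub (Real.hasDerivAt_rpow_const (Or.inl ht.ne'))

lemma rpow_rpow_cancel {r u : ℝ} (hr : r ≠ 0) (hu : 0 ≤ u) : (u ^ (2 / r)) ^ (r / 2) = u := by
  rw [← Real.rpow_mul hu, div_mul_div_cancel₀ hr, div_self two_ne_zero, Real.rpow_one]

/-- At a local minimizer on the curve the squared norm does not decrease in `t`, because otherwise
the second-order condition on the hyperplane orthogonal to `x` fails at the projection of `e`. -/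
lemma inner_resolventCurve_nonneg [FiniteDimensional ℝ E] (hT : T.IsSymmetric) (hp : 2 < p)
    (hσ : 0 < σ) {x y e : E} (hx : IsLocalMin (objective T c σ p) x)
    (hy : T y + (σ * ‖x‖ ^ (p - 2)) • y = -σ • x) (he : ‖e‖ = 1) {α₀ : ℝ} (hTe : T e = α₀ • e)
    (hneg : α₀ + σ * ‖x‖ ^ (p - 2) < 0) : 0 ≤ inner ℝ x y := by
  by_contra! hμ
  set τ := σ * ‖x‖ ^ (p - 2) with hτ
  set μ := inner ℝ x y with hμdef
  set x1 := inner ℝ x e with hx1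
  have hee : inner ℝ e e = 1 := by rw [real_inner_self_eq_norm_sq, he, one_pow]
  have hye : (α₀ + τ) * inner ℝ y e = -σ * x1 := by
    have h := congrArg (fun z => inner ℝ z e) hy
    simp only [inner_add_left, real_inner_smul_left] at h
    rw [hT, hTe, real_inner_smul_right] at h
    linarith
  set z := e - (x1 / μ) • y with hz
  have hxz : inner ℝ x z = 0 := by
    rw [hz, inner_sub_right, real_inner_smul_right, ← hμdef, div_mul_cancel₀ _ hμ.ne, sub_self]
  have hzx : inner ℝ z x = 0 := by rw [real_inner_comm, hxz]
  have h := form_nonneg_of_isLocalMin hT hp hx hxz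
  have hAz : T z + τ • z = (α₀ + τ) • e + (x1 / μ * σ) • x := by
    have : T z + τ • z = T e + τ • e - (x1 / μ) • (T y + τ • y) := by
      rw [hz, map_sub, map_smul]; module
    rw [this, hy, hTe]; module
  have hform : inner ℝ z (T z) + τ * ‖z‖ ^ 2 = (α₀ + τ) + σ * x1 ^ 2 / μ := by
    have : inner ℝ z (T z) + τ * ‖z‖ ^ 2 = inner ℝ z (T z + τ • z) := by
      rw [inner_add_right, real_inner_smul_right, real_inner_self_eq_norm_sq]
    rw [this, hAz, inner_add_right, real_inner_smul_right, real_inner_smul_right, hzx, hz,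
      inner_sub_left, real_inner_smul_left, hee]
    have : (α₀ + τ) * (1 - x1 / μ * inner ℝ y e) =
        (α₀ + τ) - x1 / μ * ((α₀ + τ) * inner ℝ y e) := by ring
    rw [mul_zero, add_zero, this, hye]
    ring
  rw [← hτ, hform] at h
  have : σ * x1 ^ 2 / μ ≤ 0 := div_nonpos_of_nonneg_of_nonpos (by positivity) hμ.le
  linarith

/-- At a local minimizer where the shifted operator has a negative eigenvalue and no kernel, the
secular function has a positive slope. Otherwise the objective decreases along the curve: to the
left if the norm increases in `t` at `t₀`, to the right if the norm is stationary there. -/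
lemma secular_slope_pos [FiniteDimensional ℝ E] (hT : T.IsSymmetric) (hp : 2 < p)
    (hσ : 0 < σ) (hb : ∀ i, T (b i) = α i • b i) {t₀ : ℝ} (ht₀ : 0 < t₀)
    (hs : ∀ i, α i + σ * t₀ ≠ 0)
    (hx : IsLocalMin (objective T c σ p) (resolventCurve b α c σ t₀))
    (hn : ‖resolventCurve b α c σ t₀‖ ^ (p - 2) = t₀)
    (hn2 : ‖resolventCurve b α c σ t₀‖ ^ 2 = t₀ ^ (2 / (p - 2))) {i₀ : ι}
    (hneg : α i₀ + σ * t₀ < 0) :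
    2 / (p - 2) * t₀ ^ (2 / (p - 2) - 1) <
      2 * inner ℝ (resolventCurve b α c σ t₀) (resolventCurveDeriv b α c σ t₀) := by
  by_contra! hle
  set q := 2 / (p - 2) with hq
  have hp2 : 0 < p - 2 := by linarith
  have hq0 : 0 < q := by positivity
  have hμ : 0 ≤ inner ℝ (resolventCurve b α c σ t₀) (resolventCurveDeriv b α c σ t₀) :=
    inner_resolventCurve_nonneg hT hp hσ hx
      (by rw [hn]; exact apply_resolventCurveDeriv hT hb hs) (b.norm_eq_one i₀) (hb i₀)
      (by rw [hn]; exact hneg)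
  have hsign := eventually_sign_eq (α := α) (σ := σ) hs
  have hpos : ∀ᶠ t in 𝓝 t₀, 0 < t := lt_mem_nhds ht₀
  have hder : ∀ᶠ t in 𝓝 t₀, HasDerivAt (fun r => objective T c σ p (resolventCurve b α c σ r))
      (σ * (‖resolventCurve b α c σ t‖ ^ (p - 2) - t) *
        inner ℝ (resolventCurve b α c σ t) (resolventCurveDeriv b α c σ t)) t := by
    filter_upwards [hsign] with t ht
    exact hasDerivAt_objective_resolventCurve hT hp hb fun i => right_ne_zero_of_mul (ht i).ne'
  have hmin : ∀ᶠ t in 𝓝 t₀, objective T c σ p (resolventCurve b α c σ t₀) ≤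
      objective T c σ p (resolventCurve b α c σ t) :=
    (hasDerivAt_resolventCurve hs).continuousAt.eventually hx
  rcases hμ.lt_or_eq with hμ | hμ
  · have hcont : ContinuousAt (fun t => inner ℝ (resolventCurve b α c σ t)
        (resolventCurveDeriv b α c σ t)) t₀ := by
      refine (hasDerivAt_resolventCurve hs).continuousAt.inner ?_
      unfold resolventCurveDeriv
      refine tendsto_finsetSum _ fun i _ => ?_
      refine ContinuousAt.smul (ContinuousAt.div continuousAt_const (by fun_prop) ?_)
        continuousAt_const
      exact pow_ne_zero 2 (hs i)
    have hμ' := hcont.eventually (lt_mem_nhds hμ)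
    have hlt := eventually_lt_of_deriv_pos_left hder (by
      filter_upwards [self_mem_nhdsWithin, nhdsWithin_le_nhds hsign, nhdsWithin_le_nhds hpos,
        nhdsWithin_le_nhds hμ'] with t htt hst ht hμt
      have h := rpow_lt_norm_sq_resolventCurve hq0 ht htt hst hn2 hle
      have h' := Real.rpow_lt_rpow (by positivity) h (half_pos hp2)
      rw [rpow_rpow_cancel hp2.ne' ht.le, ← norm_rpow_eq_sq_rpow] at h'
      exact mul_pos (mul_pos hσ (sub_pos.mpr h')) hμt)
    obtain ⟨t, h1, h2⟩ := (hlt.and (nhdsWithin_le_nhds hmin)).exists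
    exact absurd h1 (not_lt.mpr h2)
  · have hslope := hasDerivAt_norm_sq_sub_rpow (b := b) (c := c) (q := q) ht₀ hs
    rw [← hμ, mul_zero, zero_sub] at hslope
    have hsec := eventually_nhdsWithin_sign_eq_of_deriv_neg
      (f := fun r => ‖resolventCurve b α c σ r‖ ^ 2 - r ^ q) (x₀ := t₀)
      (by rw [hslope.deriv]; exact neg_neg_of_pos (by positivity)) (sub_eq_zero.mpr hn2)
    have hne : resolventCurve b α c σ t₀ ≠ 0 := by
      intro h
      rw [h, norm_zero, Real.zero_rpow hp2.ne'] at hn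
      exact ht₀.ne hn
    have hlt := eventually_lt_of_deriv_neg_right hder (by
      filter_upwards [self_mem_nhdsWithin, nhdsWithin_le_nhds hsign, nhdsWithin_le_nhds hpos,
        nhdsWithin_le_nhds hsec] with t htt hst ht hsec
      have htt : t₀ < t := htt
      have hμt := inner_resolventCurve_lt hσ htt hst hne
      rw [← hμ] at hμt
      rw [sign_neg (sub_neg.mpr htt)] at hsec
      have h := sub_neg.mp (sign_eq_neg_one_iff.mp hsec)
      have h' := Real.rpow_lt_rpow (by positivity) h (half_pos hp2)
      rw [rpow_rpow_cancel hp2.ne' ht.le, ← norm_rpow_eq_sq_rpow] at h'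
      exact mul_neg_of_neg_of_pos (mul_neg_of_pos_of_neg hσ (sub_neg.mpr h')) hμt)
    obtain ⟨t, h1, h2⟩ := (hlt.and (nhdsWithin_le_nhds hmin)).exists
    exact absurd h1 (not_lt.mpr h2)

end Curve

/-! ### Sufficient conditions for a local minimizer that is not global -/

section Sufficient

variable {E : Type*} [NormedAddCommGroup E] [InnerProductSpace ℝ E] {ι : Type*} [Fintype ι]
  {T : E →ₗ[ℝ] E} {c : E} {σ p : ℝ}

/-- A quadratic lower bound for `u ↦ u ^ r` near `a` with any constant below the second
derivative. -/
lemma eventually_quadratic_le_rpow {r a K : ℝ} (hr : 1 < r) (ha : 0 < a)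
    (hK : K < r * (r - 1) * a ^ (r - 2)) :
    ∀ᶠ u in 𝓝 a, a ^ r + r * a ^ (r - 1) * (u - a) + K / 2 * (u - a) ^ 2 ≤ u ^ r := by
  let f : ℝ → ℝ := fun u => u ^ r - r * a ^ (r - 1) * (u - a) - K / 2 * (u - a) ^ 2
  have hf (u : ℝ) : HasDerivAt f (r * u ^ (r - 1) - r * a ^ (r - 1) - K * (u - a)) u := by
    have h1 := Real.hasDerivAt_rpow_const (x := u) (p := r) (Or.inr hr.le)
    have h2 := (hasDerivAt_id u).sub_const a
    refine ((h1.sub (h2.const_mul (r * a ^ (r - 1)))).sub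
      ((h2.pow 2).const_mul (K / 2))).congr_deriv ?_
    simp
    ring
  have hd : deriv f = fun u => r * u ^ (r - 1) - r * a ^ (r - 1) - K * (u - a) :=
    funext fun u => (hf u).deriv
  have hf2 : HasDerivAt (deriv f) (r * (r - 1) * a ^ (r - 2) - K) a := by
    rw [hd]
    have h1 := Real.hasDerivAt_rpow_const (x := a) (p := r - 1) (Or.inl ha.ne')
    have h2 := (hasDerivAt_id a).sub_const a
    refine (((h1.const_mul r).sub_const (r * a ^ (r - 1))).sub (h2.const_mul K)).congr_deriv ?_
    rw [show r - 1 - 1 = r - 2 by ring]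
    ring
  have hmin := isLocalMin_of_deriv_deriv_pos (f := f) (x₀ := a) (by rw [hf2.deriv]; linarith)
    (by rw [hd]; ring) (hf a).continuousAt
  filter_upwards [hmin] with u hu
  simp only [f, sub_self] at hu
  linarith

/-- A positive definite quadratic form is coercive in finite dimension. -/
lemma exists_coercive [FiniteDimensional ℝ E] [Nontrivial E] {τ κ : ℝ} {x : E}
    (h : ∀ u : E, u ≠ 0 → 0 < inner ℝ u (T u) + τ * ‖u‖ ^ 2 + κ * inner ℝ x u ^ 2) :
    ∃ m > 0, ∀ u : E, m * ‖u‖ ^ 2 ≤ inner ℝ u (T u) + τ * ‖u‖ ^ 2 + κ * inner ℝ x u ^ 2 := by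
  have hT : Continuous T := T.continuous_of_finiteDimensional
  obtain ⟨u₀, hu₀, hmin⟩ := (isCompact_sphere (0 : E) 1).exists_isMinOn
    ((NormedSpace.sphere_nonempty (E := E)).mpr zero_le_one)
    (f := fun u => inner ℝ u (T u) + τ * ‖u‖ ^ 2 + κ * inner ℝ x u ^ 2)
    (Continuous.continuousOn (by fun_prop))
  refine ⟨_, h u₀ (ne_zero_of_mem_unit_sphere ⟨u₀, hu₀⟩), fun u => ?_⟩
  rcases eq_or_ne u 0 with rfl | hu
  · simp
  · have hn : 0 < ‖u‖ := norm_pos_iff.mpr hu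
    have hm := hmin (show ‖u‖⁻¹ • u ∈ Metric.sphere (0 : E) 1 by
      simp [norm_smul, hn.ne'])
    simp only [Set.mem_ofPred_eq, map_smul, real_inner_smul_left, real_inner_smul_right, norm_smul,
      norm_inv, norm_norm] at hm
    refine (mul_le_mul_of_nonneg_right hm (sq_nonneg ‖u‖)).trans_eq ?_
    field_simp

/-- The second-order sufficient condition. The constant `σ (p - 2) ‖x‖ ^ (p - 4)` is the
coefficient of `⟪x, u⟫ ^ 2` in the Hessian. -/
lemma isLocalMin_of_form_pos [FiniteDimensional ℝ E] (hT : T.IsSymmetric) (hp : 2 < p)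
    (hσ : 0 < σ) {x : E} (hx0 : x ≠ 0) (hx : T x + c + (σ * ‖x‖ ^ (p - 2)) • x = 0) {κ : ℝ}
    (hκ0 : 0 ≤ κ) (hκ : κ < σ * (p - 2) * ‖x‖ ^ (p - 4))
    (hpos : ∀ u : E, u ≠ 0 →
      0 < inner ℝ u (T u) + σ * ‖x‖ ^ (p - 2) * ‖u‖ ^ 2 + κ * inner ℝ x u ^ 2) :
    IsLocalMin (objective T c σ p) x := by
  have : Nontrivial E := ⟨x, 0, hx0⟩
  obtain ⟨m, hm, hcoer⟩ := exists_coercive hpos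
  have hn : 0 < ‖x‖ := norm_pos_iff.mpr hx0
  have hp0 : 0 < p := by linarith
  -- `K` is chosen so that `(σ / p) (K / 2) (2 ⟪x, d⟫) ^ 2 = ½ κ ⟪x, d⟫ ^ 2`.
  have hK : p * κ / (4 * σ) < p / 2 * (p / 2 - 1) * (‖x‖ ^ 2) ^ (p / 2 - 2) := by
    rw [show p / 2 - 2 = (p - 4) / 2 by ring, ← norm_rpow_eq_sq_rpow,
      div_lt_iff₀ (by positivity)]
    nlinarith
  have hev := eventually_quadratic_le_rpow (r := p / 2) (a := ‖x‖ ^ 2) (by linarith)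
    (by positivity) hK
  have hc1 : Tendsto (fun y : E => ‖y‖ ^ 2) (𝓝 x) (𝓝 (‖x‖ ^ 2)) :=
    (continuous_norm.pow 2).tendsto x
  have hc2 : ∀ᶠ y in 𝓝 x, κ * ‖x‖ * ‖y - x‖ < m := by
    have hc : Continuous fun y : E => κ * ‖x‖ * ‖y - x‖ := by fun_prop
    exact hc.continuousAt.eventually (gt_mem_nhds (by simpa using hm))
  filter_upwards [hc1.eventually hev, hc2] with y hy1 hy2
  have hval := objective_add_sub hT hp hx (y - x)
  have hco := hcoer (y - x)
  rw [show (‖x‖ ^ 2) ^ (p / 2 - 1) = ‖x‖ ^ (p - 2) by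
    rw [norm_rpow_eq_sq_rpow x (p - 2)]; congr 1; ring] at hy1
  have hns : ‖y‖ ^ 2 - ‖x‖ ^ 2 = 2 * inner ℝ x (y - x) + ‖y - x‖ ^ 2 := by
    have := norm_add_sq_real x (y - x)
    rw [add_sub_cancel] at this
    linarith
  have hcs : -(‖x‖ * ‖y - x‖) ≤ inner ℝ x (y - x) :=
    (abs_le.mp (abs_real_inner_le_norm x (y - x))).1
  rw [add_sub_cancel] at hval
  set s := inner ℝ x (y - x)
  set ρ := ‖y - x‖ with hρ
  have hρ0 : 0 ≤ ρ := norm_nonneg _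
  have h1 : κ / 8 * (‖y‖ ^ 2 - ‖x‖ ^ 2) ^ 2 ≤
      σ / p * ((‖y‖ ^ 2) ^ (p / 2) - (‖x‖ ^ 2) ^ (p / 2)
        - p / 2 * ‖x‖ ^ (p - 2) * (‖y‖ ^ 2 - ‖x‖ ^ 2)) := by
    have h := mul_le_mul_of_nonneg_left hy1 (div_pos hσ hp0).le
    have e : σ / p * (p * κ / (4 * σ) / 2 * (‖y‖ ^ 2 - ‖x‖ ^ 2) ^ 2) =
        κ / 8 * (‖y‖ ^ 2 - ‖x‖ ^ 2) ^ 2 := by field_simp; ring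
    rw [← e]
    linarith
  have h2 : κ / 2 * s ^ 2 - κ / 2 * ‖x‖ * ρ * ρ ^ 2 ≤ κ / 8 * (‖y‖ ^ 2 - ‖x‖ ^ 2) ^ 2 := by
    rw [hns]
    have h : -(‖x‖ * ρ) * ρ ^ 2 ≤ s * ρ ^ 2 := mul_le_mul_of_nonneg_right hcs (sq_nonneg ρ)
    have h' := mul_le_mul_of_nonneg_left h hκ0
    have h'' : 0 ≤ κ * (ρ ^ 2) ^ 2 := by positivity
    linarith
  have h3 : κ * ‖x‖ * ρ * ρ ^ 2 ≤ m * ρ ^ 2 := mul_le_mul_of_nonneg_right hy2.le (sq_nonneg ρ)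
  linarith

/-- Walking from `x` to the second intersection of the line `x + ℝ y` with the sphere through `x`
lowers the objective when the shifted quadratic form is negative at `y`. -/
lemma not_isGlobalMin_of_form_neg (hT : T.IsSymmetric) (hp : 2 < p) {x y : E}
    (hx : T x + c + (σ * ‖x‖ ^ (p - 2)) • x = 0) (hxy : inner ℝ x y ≠ 0)
    (hneg : inner ℝ y (T y) + σ * ‖x‖ ^ (p - 2) * ‖y‖ ^ 2 < 0) :
    ¬ ∀ z, objective T c σ p x ≤ objective T c σ p z := by
  intro hmin
  have hy : ‖y‖ ≠ 0 := by
    intro h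
    exact hxy (by rw [norm_eq_zero.mp h, inner_zero_right])
  set a := -2 * inner ℝ x y / ‖y‖ ^ 2 with ha
  have ha0 : a ≠ 0 := div_ne_zero (mul_ne_zero (by norm_num) hxy) (pow_ne_zero 2 hy)
  have hsphere : ‖x + a • y‖ ^ 2 = ‖x‖ ^ 2 := by
    rw [norm_add_sq_real, real_inner_smul_right, norm_smul, mul_pow, Real.norm_eq_abs, sq_abs, ha]
    field_simp
    ring
  have h := objective_add_sub_of_norm_eq hT hp hx hsphere
  have e : inner ℝ (a • y) (T (a • y)) + σ * ‖x‖ ^ (p - 2) * ‖a • y‖ ^ 2 =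
      a ^ 2 * (inner ℝ y (T y) + σ * ‖x‖ ^ (p - 2) * ‖y‖ ^ 2) := by
    rw [map_smul, real_inner_smul_left, real_inner_smul_right, norm_smul, mul_pow,
      Real.norm_eq_abs, sq_abs]
    ring
  rw [e] at h
  have := mul_neg_of_pos_of_neg (by positivity : 0 < a ^ 2) hneg
  linarith [hmin (x + a • y)]

variable {b : OrthonormalBasis ι ℝ E} {α : ι → ℝ}

lemma form_eq_sum (hT : T.IsSymmetric) (hb : ∀ i, T (b i) = α i • b i) (τ : ℝ) (u : E) :
    inner ℝ u (T u) + τ * ‖u‖ ^ 2 = ∑ i, (α i + τ) * inner ℝ (b i) u ^ 2 := by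
  rw [← b.sum_inner_mul_inner, ← b.sum_sq_norm_inner_right u, Finset.mul_sum,
    ← Finset.sum_add_distrib]
  refine Finset.sum_congr rfl fun i _ => ?_
  rw [inner_basis_apply hT hb, real_inner_comm, Real.norm_eq_abs, sq_abs]
  ring

lemma form_pos_of_orthogonal (hT : T.IsSymmetric) (hb : ∀ i, T (b i) = α i • b i) {τ : ℝ} {i₀ : ι}
    (hpos : ∀ i, i ≠ i₀ → 0 < α i + τ) {u : E} (hu : inner ℝ (b i₀) u = 0) (hu0 : u ≠ 0) :
    0 < inner ℝ u (T u) + τ * ‖u‖ ^ 2 := by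
  rw [form_eq_sum hT hb]
  obtain ⟨j, hj⟩ : ∃ j, inner ℝ (b j) u ≠ 0 := by
    by_contra! h
    exact hu0 (ext_inner_basis (b := b) fun i => by rw [h, inner_zero_right])
  have hji : j ≠ i₀ := fun h => hj (h ▸ hu)
  refine Finset.sum_pos' (fun i _ => ?_) ⟨j, Finset.mem_univ j, ?_⟩
  · rcases eq_or_ne i i₀ with rfl | hi
    · rw [hu]; simp
    · exact mul_nonneg (hpos i hi).le (sq_nonneg _)
  · exact mul_pos (hpos j hji) (by positivity)

/-- Adding `κ ⟪x, ·⟫ ^ 2` to the shifted form, which has a single negative direction, makes it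
positive definite as soon as this repairs the direction `y` conjugate to the hyperplane orthogonal
to `x`. -/
lemma form_add_pos (hT : T.IsSymmetric) (hb : ∀ i, T (b i) = α i • b i) {τ κ : ℝ} {i₀ : ι}
    (hpos : ∀ i, i ≠ i₀ → 0 < α i + τ) (hσ : 0 < σ) {x y : E} (hy : T y + τ • y = -σ • x)
    (hμ : 0 < inner ℝ x y) (hκ : σ < κ * inner ℝ x y) {u : E} (hu : u ≠ 0) :
    0 < inner ℝ u (T u) + τ * ‖u‖ ^ 2 + κ * inner ℝ x u ^ 2 := by
  set μ := inner ℝ x y with hμdef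
  have hform (w : E) : inner ℝ w (T w) + τ * ‖w‖ ^ 2 = inner ℝ w (T w + τ • w) := by
    rw [inner_add_right, real_inner_smul_right, real_inner_self_eq_norm_sq]
  have hsplit (w : E) (a : ℝ) (hw : inner ℝ x w = 0) :
      inner ℝ (w + a • y) (T (w + a • y)) + τ * ‖w + a • y‖ ^ 2 =
        inner ℝ w (T w) + τ * ‖w‖ ^ 2 - a ^ 2 * (σ * μ) := by
    have e1 : T (w + a • y) + τ • (w + a • y) = (T w + τ • w) + a • (T y + τ • y) := by
      rw [map_add, map_smul]; module
    have e2 : inner ℝ y (T w + τ • w) = 0 := by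
      rw [inner_add_right, real_inner_smul_right, ← hT, ← real_inner_smul_left,
        ← inner_add_left, hy, real_inner_smul_left, hw, mul_zero]
    have e3 : inner ℝ w x = 0 := by rw [real_inner_comm, hw]
    have e4 : inner ℝ y x = μ := by rw [real_inner_comm]
    rw [hform, hform, e1, hy]
    simp only [inner_add_left w, inner_add_right _ (T w + τ • w), real_inner_smul_left,
      real_inner_smul_right, e2, e3, e4]
    ring
  -- The form is positive on the hyperplane orthogonal to `x`.
  have hperp (z : E) (hz : inner ℝ x z = 0) (hz0 : z ≠ 0) :
      0 < inner ℝ z (T z) + τ * ‖z‖ ^ 2 := by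
    by_contra! hle
    have hyneg : inner ℝ y (T y) + τ * ‖y‖ ^ 2 < 0 := by
      have := hsplit 0 1 (inner_zero_right x)
      simp only [zero_add, one_smul, inner_zero_left, norm_zero] at this
      nlinarith [mul_pos hσ hμ]
    have hy1 : inner ℝ (b i₀) y ≠ 0 := by
      intro h
      have hy0 : y ≠ 0 := by
        rintro rfl
        exact hμ.ne' (inner_zero_right x)
      exact absurd hyneg (not_lt.mpr (form_pos_of_orthogonal hT hb hpos h hy0).le)
    set a := -(inner ℝ (b i₀) z / inner ℝ (b i₀) y) with ha
    have hv1 : inner ℝ (b i₀) (z + a • y) = 0 := by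
      rw [inner_add_right, real_inner_smul_right, ha]
      field_simp
      ring
    have hv : z + a • y = 0 := by
      by_contra h0
      have h := form_pos_of_orthogonal hT hb hpos hv1 h0
      rw [hsplit z a hz] at h
      nlinarith [mul_pos hσ hμ, sq_nonneg a, mul_nonneg (sq_nonneg a) (mul_pos hσ hμ).le]
    have ha0 : a * μ = 0 := by
      have h := congrArg (inner ℝ x) hv
      rwa [inner_add_right, real_inner_smul_right, hz, inner_zero_right, zero_add] at h
    rw [(mul_eq_zero.mp ha0).resolve_right hμ.ne', zero_smul, add_zero] at hv
    exact hz0 hv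
  set a := inner ℝ x u / μ with ha
  have hau : inner ℝ x u = a * μ := by rw [ha, div_mul_cancel₀ _ hμ.ne']
  have hz : inner ℝ x (u - a • y) = 0 := by
    rw [inner_sub_right, real_inner_smul_right, hau, ← hμdef, sub_self]
  have h := hsplit (u - a • y) a hz
  rw [sub_add_cancel] at h
  rw [h, hau]
  rcases eq_or_ne (u - a • y) 0 with h0 | h0
  · have ha0 : a ≠ 0 := by
      intro h1
      rw [h1, zero_smul, sub_zero] at h0
      exact hu h0
    rw [h0, inner_zero_left, norm_zero]
    have h1 : 0 < a ^ 2 * (μ * (κ * μ - σ)) :=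
      mul_pos (by positivity) (mul_pos hμ (sub_pos.mpr hκ))
    linarith
  · have h1 : 0 ≤ a ^ 2 * (μ * (κ * μ - σ)) :=
      mul_nonneg (sq_nonneg a) (mul_pos hμ (sub_pos.mpr hκ)).le
    linarith [hperp _ hz h0]

/-! ### The characterization in an eigenbasis -/

/-- A point of the curve at a zero of the secular function with positive slope, where exactly one
eigenvalue of the shifted operator is negative and the others are positive, is a local but not a
global minimizer. -/
lemma isLocalMin_resolventCurve [FiniteDimensional ℝ E] (hT : T.IsSymmetric) (hp : 2 < p)
    (hσ : 0 < σ) (hb : ∀ i, T (b i) = α i • b i) {t : ℝ} (ht : 0 < t) {i₀ : ι}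
    (hneg : α i₀ + σ * t < 0) (hpos : ∀ i, i ≠ i₀ → 0 < α i + σ * t)
    (hn2 : ‖resolventCurve b α c σ t‖ ^ 2 = t ^ (2 / (p - 2)))
    (hslope : 2 / (p - 2) * t ^ (2 / (p - 2) - 1) <
      2 * inner ℝ (resolventCurve b α c σ t) (resolventCurveDeriv b α c σ t)) :
    IsLocalMin (objective T c σ p) (resolventCurve b α c σ t) ∧
      ¬ ∀ y, objective T c σ p (resolventCurve b α c σ t) ≤ objective T c σ p y := by
  have hp2 : 0 < p - 2 := by linarith
  have hs (i) : α i + σ * t ≠ 0 := by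
    rcases eq_or_ne i i₀ with rfl | hi
    · exact hneg.ne
    · exact (hpos i hi).ne'
  have hst := resolventCurve_stationary (c := c) hT hb hs
  have hy := apply_resolventCurveDeriv (c := c) hT hb hs
  set x := resolventCurve b α c σ t
  set y := resolventCurveDeriv b α c σ t
  have hn : ‖x‖ ^ (p - 2) = t := by
    rw [norm_rpow_eq_sq_rpow, hn2, rpow_rpow_cancel hp2.ne' ht.le]
  have hx0 : x ≠ 0 := by
    intro h
    rw [h, norm_zero, Real.zero_rpow hp2.ne'] at hn
    exact ht.ne hn
  have hxn : 0 < ‖x‖ := norm_pos_iff.mpr hx0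
  have htq : t ^ (2 / (p - 2) - 1) = (‖x‖ ^ (p - 4))⁻¹ := by
    nth_rw 1 [← hn]
    rw [← Real.rpow_mul hxn.le, ← Real.rpow_neg hxn.le]
    congr 1
    field_simp
    ring
  have hx4 : 0 < ‖x‖ ^ (p - 4) := Real.rpow_pos_of_pos hxn _
  have hμ : 0 < inner ℝ x y := by
    have : 0 < 2 / (p - 2) * t ^ (2 / (p - 2) - 1) := by positivity
    linarith
  have hgap : σ / inner ℝ x y < σ * (p - 2) * ‖x‖ ^ (p - 4) := by
    rw [htq, ← div_eq_mul_inv, div_div, div_lt_iff₀ (by positivity)] at hslope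
    rw [div_lt_iff₀ hμ]
    nlinarith
  obtain ⟨κ, hκ1, hκ2⟩ := exists_between hgap
  have hκ0 : 0 < κ := (div_pos hσ hμ).trans hκ1
  rw [← hn] at hst hy hpos
  constructor
  · exact isLocalMin_of_form_pos hT hp hσ hx0 hst hκ0.le hκ2 fun u hu =>
      form_add_pos hT hb hpos hσ hy hμ ((div_lt_iff₀ hμ).mp hκ1) hu
  · refine not_isGlobalMin_of_form_neg hT hp hst hμ.ne' ?_
    have : inner ℝ y (T y) + σ * ‖x‖ ^ (p - 2) * ‖y‖ ^ 2 =
        inner ℝ y (T y + (σ * ‖x‖ ^ (p - 2)) • y) := by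
      rw [inner_add_right, real_inner_smul_right, real_inner_self_eq_norm_sq]
    rw [this, hy, real_inner_smul_right, real_inner_comm]
    nlinarith [mul_pos hσ hμ]

/-- A local minimizer that is not global lies on the curve, at a zero of the secular function with
positive slope. -/
lemma exists_resolventCurve_eq [FiniteDimensional ℝ E] (hT : T.IsSymmetric) (hp : 2 < p)
    (hσ : 0 < σ) (hb : ∀ i, T (b i) = α i • b i) {i₀ : ι} (hα : ∀ i, α i₀ ≤ α i) {x : E}
    (hx : IsLocalMin (objective T c σ p) x)
    (hng : ¬ ∀ y, objective T c σ p x ≤ objective T c σ p y) :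
    ∃ t, 0 < t ∧ α i₀ + σ * t < 0 ∧ (∀ i, i ≠ i₀ → 0 < α i + σ * t) ∧
      x = resolventCurve b α c σ t ∧ ‖resolventCurve b α c σ t‖ ^ 2 = t ^ (2 / (p - 2)) ∧
      2 / (p - 2) * t ^ (2 / (p - 2) - 1) <
        2 * inner ℝ (resolventCurve b α c σ t) (resolventCurveDeriv b α c σ t) := by
  have hp2 : 0 < p - 2 := by linarith
  have hst := gradient_eq_zero_of_isLocalMin hT hp hx
  obtain ⟨t, ht⟩ : ∃ t, t = ‖x‖ ^ (p - 2) := ⟨_, rfl⟩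
  have hneg : α i₀ + σ * t < 0 := by
    by_contra! h
    refine hng (isGlobalMin_of_form_nonneg hT hp hσ hst fun d => ?_)
    rw [form_eq_sum hT hb, ← ht]
    exact Finset.sum_nonneg fun i _ => mul_nonneg (by linarith [hα i]) (sq_nonneg _)
  have hx0 : x ≠ 0 := by
    intro h0
    have h := form_nonneg_of_isLocalMin hT hp hx (u := b i₀) (by rw [h0, inner_zero_left])
    rw [hb, real_inner_smul_right, real_inner_self_eq_norm_sq, b.norm_eq_one, ← ht] at h
    linarith
  have ht0 : 0 < t := ht ▸ Real.rpow_pos_of_pos (norm_pos_iff.mpr hx0) _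
  have hpos (i) (hi : i ≠ i₀) : 0 < α i + σ * t := by
    rw [ht]
    exact pos_of_orthonormal_eigenvectors hT hp hx (b.norm_eq_one i₀) (b.norm_eq_one i)
      (b.orthonormal.2 hi.symm) (hb i₀) (hb i) (ht ▸ hneg)
  have hs (i) : α i + σ * t ≠ 0 := by
    rcases eq_or_ne i i₀ with rfl | hi
    · exact hneg.ne
    · exact (hpos i hi).ne'
  have hxc : x = resolventCurve b α c σ t :=
    eq_resolventCurve_of_stationary hT hb hs (ht ▸ hst)
  have hn2 : ‖x‖ ^ 2 = t ^ (2 / (p - 2)) := by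
    rw [ht, ← Real.rpow_mul (norm_nonneg x), mul_div_cancel₀ _ hp2.ne', Real.rpow_two]
  rw [hxc] at hx ht hn2
  exact ⟨t, ht0, hneg, hpos, hxc, hn2, secular_slope_pos hT hp hσ hb ht0 hs hx ht.symm hn2 hneg⟩

end Sufficient

/-! ### Translation to matrices -/

section Matrix

variable {n : ℕ} {H : Matrix (Fin n) (Fin n) ℝ}

lemma incEigenvalues_monotone (hH : H.IsHermitian) : Monotone (incEigenvalues hH) :=
  fun i j hij => hH.eigenvalues₀_antitone (by simpa [Fin.le_def] using Fin.rev_le_rev.mpr hij)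

lemma exists_incEigenbasis (hH : H.IsHermitian) :
    ∃ b : OrthonormalBasis (Fin n) ℝ (EuclideanSpace ℝ (Fin n)),
      ∀ i, Matrix.toEuclideanLin H (b i) = incEigenvalues hH i • b i := by
  let e : Fin n ≃ Fin n :=
    (Fintype.equivOfCardEq (Fintype.card_fin (Fintype.card (Fin n)))).symm.trans
      ((finCongr (Fintype.card_fin n)).trans Fin.revPerm)
  refine ⟨hH.eigenvectorBasis.reindex e, fun i => ?_⟩
  have h : hH.eigenvalues (e.symm i) = incEigenvalues hH i := by
    simp [Matrix.IsHermitian.eigenvalues, incEigenvalues, e]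
  rw [OrthonormalBasis.reindex_apply, Matrix.toLpLin_apply,
    hH.mulVec_eigenvectorBasis, h]
  rfl

lemma mem_secularInterval_iff (hn : 1 ≤ n) (hH : H.IsHermitian) {σ : ℝ} (hσ : 0 < σ) (t : ℝ) :
    t ∈ secularInterval hn hH σ ↔ 0 < t ∧ incEigenvalues hH ⟨0, hn⟩ + σ * t < 0 ∧
      ∀ i, i ≠ ⟨0, hn⟩ → 0 < incEigenvalues hH i + σ * t := by
  rw [secularInterval, Set.mem_Ioo, lt_div_iff₀ hσ]
  split_ifs with h
  · rw [max_lt_iff, div_lt_iff₀ hσ]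
    constructor
    · rintro ⟨⟨h1, h2⟩, h3⟩
      refine ⟨h2, by linarith, fun i hi => ?_⟩
      have hle : (⟨1, h⟩ : Fin n) ≤ i := by
        rw [Fin.le_def]
        exact Nat.one_le_iff_ne_zero.mpr fun h0 => hi (Fin.ext h0)
      linarith [incEigenvalues_monotone hH hle]
    · rintro ⟨h1, h2, h3⟩
      have := h3 ⟨1, h⟩ (by simp [Fin.ext_iff])
      exact ⟨⟨by linarith, h1⟩, by linarith⟩
  · constructor
    · rintro ⟨h1, h2⟩
      refine ⟨h1, by linarith, fun i hi => absurd (Fin.ext ?_) hi⟩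
      have := i.isLt
      simp only
      omega
    · rintro ⟨h1, h2, -⟩
      exact ⟨h1, by linarith⟩

lemma neg_resolventVec_eq {b : OrthonormalBasis (Fin n) ℝ (EuclideanSpace ℝ (Fin n))}
    {α : Fin n → ℝ} (hH : H.IsHermitian) (hb : ∀ i, Matrix.toEuclideanLin H (b i) = α i • b i)
    (c : EuclideanSpace ℝ (Fin n)) {σ t : ℝ} (hs : ∀ i, α i + σ * t ≠ 0) :
    -resolventVec H c σ t = resolventCurve b α c σ t := by
  have hT := Matrix.isSymmetric_toEuclideanLin_iff.mpr hH
  set M := (σ * t) • (1 : Matrix (Fin n) (Fin n) ℝ) + H with hM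
  have hMx (x : EuclideanSpace ℝ (Fin n)) :
      Matrix.toEuclideanLin M x = Matrix.toEuclideanLin H x + (σ * t) • x := by
    rw [hM, map_add, map_smul, LinearMap.add_apply, LinearMap.smul_apply, Matrix.toLpLin_one,
      LinearMap.id_apply, add_comm]
  have hdet : IsUnit M.det := by
    rw [isUnit_iff_ne_zero]
    intro h0
    obtain ⟨v, hv, hMv⟩ := Matrix.exists_mulVec_eq_zero_iff.mpr h0
    have h1 : Matrix.toEuclideanLin M (WithLp.toLp 2 v) = 0 := by
      rw [Matrix.toLpLin_toLp, Matrix.toLin'_apply, hMv]; rfl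
    rw [hMx] at h1
    have h2 := eq_resolventCurve_of_stationary (c := 0) hT hb hs (by rw [add_zero, h1])
    simp only [resolventCurve, inner_zero_right, neg_zero, zero_div, zero_smul,
      Finset.sum_const_zero] at h2
    exact hv (congrArg WithLp.ofLp h2)
  have hst := resolventCurve_stationary (c := c) hT hb hs
  set x := resolventCurve b α c σ t
  have hc : c = -Matrix.toEuclideanLin M x := by
    rw [hMx, eq_neg_iff_add_eq_zero, ← hst]; abel
  rw [resolventVec, ← hM, hc, map_neg, neg_neg, ← LinearMap.comp_apply,
    ← Matrix.toLpLin_mul_same, Matrix.nonsing_inv_mul _ hdet, Matrix.toLpLin_one,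
    LinearMap.id_apply]

/-- The secular function and its derivative in terms of the curve. -/
lemma secular_eq_and_hasDerivAt {b : OrthonormalBasis (Fin n) ℝ (EuclideanSpace ℝ (Fin n))}
    {α : Fin n → ℝ} (hH : H.IsHermitian) (hb : ∀ i, Matrix.toEuclideanLin H (b i) = α i • b i)
    (c : EuclideanSpace ℝ (Fin n)) (p : ℝ) {σ t : ℝ} (ht : 0 < t) (hs : ∀ i, α i + σ * t ≠ 0) :
    secular H c σ p t = ‖resolventCurve b α c σ t‖ ^ 2 - t ^ (2 / (p - 2)) ∧
    HasDerivAt (secular H c σ p)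
      (2 * inner ℝ (resolventCurve b α c σ t) (resolventCurveDeriv b α c σ t)
        - 2 / (p - 2) * t ^ (2 / (p - 2) - 1)) t := by
  have heq {r : ℝ} (hr : ∀ i, α i + σ * r ≠ 0) :
      secular H c σ p r = ‖resolventCurve b α c σ r‖ ^ 2 - r ^ (2 / (p - 2)) := by
    rw [secular, ← norm_neg, neg_resolventVec_eq hH hb c hr]
  refine ⟨heq hs, (hasDerivAt_norm_sq_sub_rpow ht hs).congr_of_eventuallyEq ?_⟩
  filter_upwards [eventually_sign_eq hs] with r hr
  exact heq fun i => right_ne_zero_of_mul (hr i).ne'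

end Matrix

end PRegularized

theorem theorem3 {n : ℕ} (hn : 1 ≤ n) (H : Matrix (Fin n) (Fin n) ℝ) (hH : H.IsHermitian)
    (c : EuclideanSpace ℝ (Fin n)) (σ p : ℝ) (hσ : 0 < σ) (hp : 2 < p)
    (x : EuclideanSpace ℝ (Fin n)) :
    IsLocalNonglobalMin (pRS H c σ p) x ↔
      ∃ t ∈ secularInterval hn hH σ,
        secular H c σ p t = 0 ∧ 0 < deriv (secular H c σ p) t ∧ x = -resolventVec H c σ t := by
  obtain ⟨b, hb⟩ := PRegularized.exists_incEigenbasis hH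
  have hT := Matrix.isSymmetric_toEuclideanLin_iff.mpr hH
  constructor
  · rintro ⟨hx, hng⟩
    obtain ⟨t, ht, hneg, hpos, hxc, hn2, hslope⟩ :=
      PRegularized.exists_resolventCurve_eq (i₀ := ⟨0, hn⟩) hT hp hσ hb
        (fun i => PRegularized.incEigenvalues_monotone hH (Nat.zero_le i)) hx hng
    have hs (i) : incEigenvalues hH i + σ * t ≠ 0 := by
      rcases eq_or_ne i ⟨0, hn⟩ with rfl | hi
      · exact hneg.ne
      · exact (hpos i hi).ne'
    obtain ⟨h0, h1⟩ := PRegularized.secular_eq_and_hasDerivAt hH hb c p ht hs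
    refine ⟨t, (PRegularized.mem_secularInterval_iff hn hH hσ t).mpr ⟨ht, hneg, hpos⟩, ?_, ?_, ?_⟩
    · rw [h0, hn2, sub_self]
    · rw [h1.deriv]
      exact sub_pos.mpr hslope
    · rw [PRegularized.neg_resolventVec_eq hH hb c hs, hxc]
  · rintro ⟨t, htmem, hsec, hder, rfl⟩
    obtain ⟨ht, hneg, hpos⟩ := (PRegularized.mem_secularInterval_iff hn hH hσ t).mp htmem
    have hs (i) : incEigenvalues hH i + σ * t ≠ 0 := by
      rcases eq_or_ne i ⟨0, hn⟩ with rfl | hi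
      · exact hneg.ne
      · exact (hpos i hi).ne'
    obtain ⟨h0, h1⟩ := PRegularized.secular_eq_and_hasDerivAt hH hb c p ht hs
    rw [h1.deriv] at hder
    rw [PRegularized.neg_resolventVec_eq hH hb c hs]
    exact PRegularized.isLocalMin_resolventCurve hT hp hσ hb ht hneg hpos
      (sub_eq_zero.mp (h0.symm.trans hsec)) (sub_pos.mp hder)
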